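/- Let $M$ be a smooth manifold with boundary, of dimension $n\ge 1$, let $\kappa\in\mathbb R$ be a constant, and let $g=g(t)$, $0<t<T$, be a family of Riemannian metrics on $M$, smooth on $M\times(0,T)$ up to the boundary, which solves $$\partial_t g=-2\,\mathrm{Ric}(g)\ \text{ on } M\times(0,T),\qquad h=\kappa\, g\ \text{ on } \partial M\times(0,T).$$ Here $\nu$ is the outward unit normal of $\partial M$ with respect to $g(t)$, and $h_{\alpha\beta}=g(\nabla_\alpha\nu,\partial_\beta)$ is the second fundamental form of $\partial M$ with respect to $\nu$ (so $h=g$ on the boundary of the Euclidean unit ball). Greek indices $\alpha,\beta$ refer to time-independent local coordinates on $\partial M$ (induced by coordinates of $M$ adapted to the boundary), $g^{\alpha\beta}$ is the inverse of the metric $g_{\alpha\beta}$ induced on $\partial M$, $H=g^{\alpha\beta}h_{\alpha\beta}$, $R_{ij}$ are the components of the Ricci tensor, $R_{\nu\nu}=\mathrm{Ric}(\nu,\nu)$, and $R_{\nu\nu|\nu}=(\nabla_\nu \mathrm{Ric})(\nu,\nu)$, with $\nabla$ the Levi-Civita connection of $g(t)$. Then at every point of $\partial M$ and every time $t\in(0,T)$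 the components $h_{\alpha\beta}$ are differentiable in $t$ and $$R_{\nu\nu|\nu}=-g^{\alpha\beta}\frac{\partial}{\partial t}h_{\alpha\beta}-H R_{\nu\nu}=2\kappa\, g^{\alpha\beta}R_{\alpha\beta}-(n-1)\kappa R_{\nu\nu}.$$ In particular, if $n=3$, then $$R_{\nu\nu|\nu}=2\kappa\left[g^{\alpha\beta}R_{\alpha\beta}-R_{\nu\nu}\right].$$ -/

import Mathlib

open scoped Manifold ContDiff

/-! Classical tensor calculus in one coordinate chart of a manifold with boundary of dimension
`m + 1`. Coordinates are `y 0 ≥ 0, y 1, …, y m`, and the boundary is `y 0 = 0`. Latin indices run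
over `Fin (m + 1)`; a tangential (Greek) index `α : Fin m` stands for the coordinate `α.succ`. -/

namespace RicciBoundary

/-- A field of matrices on the coordinate space: the components of a covariant 2-tensor. -/
abbrev Field2 (m : ℕ) : Type :=
  EuclideanSpace ℝ (Fin (m + 1)) → Matrix (Fin (m + 1)) (Fin (m + 1)) ℝ

noncomputable section

/-- The partial derivative `∂_k f` at `y`, within the half space `{y | 0 ≤ y 0}` (hence one-sided
in the direction normal to the boundary at points with `y 0 = 0`). -/
def pd {m : ℕ} (k : Fin (m + 1)) (f : EuclideanSpace ℝ (Fin (m + 1)) → ℝ)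
    (y : EuclideanSpace ℝ (Fin (m + 1))) : ℝ :=
  fderivWithin ℝ f (Set.range (𝓡∂ (m + 1))) y (EuclideanSpace.single k 1)

/-- Christoffel symbols `Γ^k_{ij}` of the Levi-Civita connection of the metric `g`. -/
def christoffel {m : ℕ} (g : Field2 m) (k i j : Fin (m + 1))
    (y : EuclideanSpace ℝ (Fin (m + 1))) : ℝ :=
  (1 / 2) * ∑ l, (g y)⁻¹ k l *
    (pd i (fun z => g z j l) y + pd j (fun z => g z i l) y - pd l (fun z => g z i j) y)

/-- Components `R_{ij}` of the Ricci tensor of `g` (positive on round spheres). -/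
def ricci {m : ℕ} (g : Field2 m) : Field2 m := fun y =>
  Matrix.of fun i j =>
    ∑ k, pd k (christoffel g k i j) y - ∑ k, pd j (christoffel g k i k) y
      + ∑ k, ∑ l, (christoffel g k k l y * christoffel g l i j y
          - christoffel g k j l y * christoffel g l i k y)

/-- Components `S_{ij|k}` of the covariant derivative, with respect to the Levi-Civita connection
of `g`, of a covariant 2-tensor `S`. -/
def covDeriv {m : ℕ} (g S : Field2 m) (i j k : Fin (m + 1))
    (y : EuclideanSpace ℝ (Fin (m + 1))) : ℝ :=
  pd k (fun z => S z i j) y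
    - ∑ l, christoffel g l k i y * S y l j - ∑ l, christoffel g l k j y * S y i l

/-- Components `ν^i` of the outward unit normal: minus the normalized gradient of the coordinate
`y 0`. -/
def normal {m : ℕ} (g : Field2 m) (y : EuclideanSpace ℝ (Fin (m + 1))) (i : Fin (m + 1)) : ℝ :=
  -((g y)⁻¹ i 0 / Real.sqrt ((g y)⁻¹ 0 0))

/-- Components `h_{αβ} = g(∇_α ν, ∂_β) = -g(∇_α ∂_β, ν)` of the second fundamental form of the
boundary with respect to the outward unit normal `ν` (so that the unit ball has `h = g`). -/
def secondFF {m : ℕ} (g : Field2 m) (y : EuclideanSpace ℝ (Fin (m + 1))) :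
    Matrix (Fin m) (Fin m) ℝ :=
  Matrix.of fun α β =>
    -∑ k, ∑ l, g y k l * christoffel g k α.succ β.succ y * normal g y l

/-- The restriction `S_{αβ}` of a covariant 2-tensor to directions tangent to the boundary. -/
def tangential {m : ℕ} (S : Field2 m) (y : EuclideanSpace ℝ (Fin (m + 1))) :
    Matrix (Fin m) (Fin m) ℝ :=
  Matrix.of fun α β => S y α.succ β.succ

/-- The trace `g^{αβ} A_{αβ}`, where `g^{αβ}` is the inverse of the metric `g_{αβ}` induced on the
boundary. -/
def boundaryTrace {m : ℕ} (g : Field2 m) (y : EuclideanSpace ℝ (Fin (m + 1)))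
    (A : Matrix (Fin m) (Fin m) ℝ) : ℝ :=
  ∑ α, ∑ β, (tangential g y)⁻¹ α β * A α β

/-- The mean curvature `H = g^{αβ} h_{αβ}` of the boundary. -/
def meanCurvature {m : ℕ} (g : Field2 m) (y : EuclideanSpace ℝ (Fin (m + 1))) : ℝ :=
  boundaryTrace g y (secondFF g y)

/-- `R_{νν} = R_{ij} ν^i ν^j`. -/
def ricciNormal {m : ℕ} (g : Field2 m) (y : EuclideanSpace ℝ (Fin (m + 1))) : ℝ :=
  ∑ i, ∑ j, ricci g y i j * normal g y i * normal g y j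

/-- `R_{νν|ν} = R_{ij|k} ν^i ν^j ν^k`. -/
def ricciNormalDeriv {m : ℕ} (g : Field2 m) (y : EuclideanSpace ℝ (Fin (m + 1))) : ℝ :=
  ∑ i, ∑ j, ∑ k, covDeriv g (ricci g) i j k y * normal g y i * normal g y j * normal g y k

/-- Smooth Riemannian metrics on a manifold with boundary of dimension `m + 1`. -/
abbrev Metric (m : ℕ) (M : Type*) [TopologicalSpace M]
    [ChartedSpace (EuclideanHalfSpace (m + 1)) M] [IsManifold (𝓡∂ (m + 1)) ∞ M] : Type _ :=
  Bundle.ContMDiffRiemannianMetric (𝓡∂ (m + 1)) ∞ (EuclideanSpace ℝ (Fin (m + 1)))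
    (fun x : M => TangentSpace (𝓡∂ (m + 1)) x)

/-- The components `g_{ij} = g(∂_i, ∂_j)` of a metric in the chart `e`, as functions of the
coordinates `y`; here `∂_i` is the image of the `i`-th basis vector under the derivative of the
inverse of the chart. -/
def components {m : ℕ} {M : Type*} [TopologicalSpace M]
    [ChartedSpace (EuclideanHalfSpace (m + 1)) M] [IsManifold (𝓡∂ (m + 1)) ∞ M]
    (g : Metric m M) (e : OpenPartialHomeomorph M (EuclideanHalfSpace (m + 1))) : Field2 m :=
  fun y => Matrix.of fun i j =>
    g.inner ((e.extend (𝓡∂ (m + 1))).symm y)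
      (mfderivWithin 𝓘(ℝ, EuclideanSpace ℝ (Fin (m + 1))) (𝓡∂ (m + 1))
        (e.extend (𝓡∂ (m + 1))).symm (Set.range (𝓡∂ (m + 1))) y (EuclideanSpace.single i (1 : ℝ)))
      (mfderivWithin 𝓘(ℝ, EuclideanSpace ℝ (Fin (m + 1))) (𝓡∂ (m + 1))
        (e.extend (𝓡∂ (m + 1))).symm (Set.range (𝓡∂ (m + 1))) y (EuclideanSpace.single j (1 : ℝ)))

/-- `g` is a smooth solution on `M × (0, T)` of the Ricci flow `∂_t g = -2 Ric(g)` with the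
boundary condition `h = κ g` on `∂M`, where `κ` is a constant. The equations are written in the
charts of the manifold. Only the values `g t` with `0 < t < T` matter. -/
structure IsUmbilicRicciFlow {m : ℕ} {M : Type*} [TopologicalSpace M]
    [ChartedSpace (EuclideanHalfSpace (m + 1)) M] [IsManifold (𝓡∂ (m + 1)) ∞ M]
    (g : ℝ → Metric m M) (κ T : ℝ) : Prop where
  /-- The components of `g` are smooth functions of time and space, up to the boundary. -/
  smooth : ∀ e ∈ atlas (EuclideanHalfSpace (m + 1)) M, ∀ i j : Fin (m + 1),
    ContDiffOn ℝ ∞ (fun q : ℝ × EuclideanSpace ℝ (Fin (m + 1)) => components (g q.1) e q.2 i j)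
      (Set.Ioo 0 T ×ˢ (e.extend (𝓡∂ (m + 1))).target)
  /-- `∂_t g_{ij} = -2 R_{ij}`. -/
  flow : ∀ e ∈ atlas (EuclideanHalfSpace (m + 1)) M, ∀ t ∈ Set.Ioo 0 T,
    ∀ p ∈ e.source, ∀ i j : Fin (m + 1),
      HasDerivAt (fun s => components (g s) e (e.extend (𝓡∂ (m + 1)) p) i j)
        (-2 * ricci (components (g t) e) (e.extend (𝓡∂ (m + 1)) p) i j) t
  /-- `h_{αβ} = κ g_{αβ}` on the boundary. -/
  umbilic : ∀ e ∈ atlas (EuclideanHalfSpace (m + 1)) M, ∀ t ∈ Set.Ioo 0 T,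
    ∀ p ∈ e.source, p ∈ (𝓡∂ (m + 1)).boundary M →
      secondFF (components (g t) e) (e.extend (𝓡∂ (m + 1)) p)
        = κ • tangential (components (g t) e) (e.extend (𝓡∂ (m + 1)) p)

end

end RicciBoundary

/-!
The identity for `R_{νν|ν}` holds under Ricci flow for every boundary, umbilic or not; the boundary
condition only enters at the end, where it turns `∂_t h_{αβ}` into `-2κ R_{αβ}` and `H` into
`m κ`.

In coordinates with `y 0 ≥ 0` the second fundamental form is `h_{αβ} = Γ^0_{αβ} / √(g^{00})`
(`secondFF_apply`). Under a variation `v = ∂_t g` of the metric the Christoffel symbols change by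
`½ g^{kl} (v_{jl|i} + v_{il|j} - v_{ij|l})` (`Formal.derivation_chr`), and `g^{00}` changes by
`-g^{00} v_{νν}`. With `v = -2 Ric` this gives (`hasDerivAt_secondFF`)
`∂_t h_{αβ} = R_{βν|α} + R_{αν|β} - R_{αβ|ν} - R_{νν} h_{αβ}`.
The inverse of the induced metric is the tangential block of `g^{ij} - ν^i ν^j`
(`tangential_inv`), whose other entries vanish. In the trace of the above formula the part coming
from `g^{ij}` is `2 g^{ij} R_{iν|j} - g^{ij} R_{ij|ν}`, which is zero by the contracted Bianchi
identity (`Formal.contracted_bianchi`), and the part coming from `ν^i ν^j` is `-R_{νν|ν}`. Hence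
`g^{αβ} ∂_t h_{αβ} = -R_{νν|ν} - H R_{νν}` (`ricciNormalDeriv_eq`).

The Bianchi identity and the variation formula are identities of formal differential calculus. They
are proved in a commutative algebra with commuting derivations, where the curvature is a matrix
`∂_i Γ_j - ∂_j Γ_i + [Γ_i, Γ_j]`. They are then applied to the algebra `smoothOn Ω` of smooth
functions on space-time `Ω = (0, T) × D`, where `D` is the image of a chart. The derivatives up to
the boundary commute since `Ω` lies in the closure of its interior (`smoothOn.dirDeriv_comm`).
-/

namespace RicciBoundary

/-! ### The Bianchi identity and the variation of the connection in a differential algebra -/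

namespace Formal

variable {A : Type*} [CommRing A] [Algebra ℝ A]
variable {ι : Type*}

/-- A derivation of `A` applied to each entry of a matrix. -/
def entrywise (D : Derivation ℝ A A) : Matrix ι ι A →ₗ[ℝ] Matrix ι ι A :=
  (D : A →ₗ[ℝ] A).mapMatrix

@[simp]
theorem entrywise_apply (D : Derivation ℝ A A) (P : Matrix ι ι A) (i j : ι) :
    entrywise D P i j = D (P i j) := rfl

theorem entrywise_mul [Fintype ι] (D : Derivation ℝ A A) (P Q : Matrix ι ι A) :
    entrywise D (P * Q) = entrywise D P * Q + P * entrywise D Q := by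
  ext i j
  simp only [entrywise_apply, Matrix.mul_apply, Matrix.add_apply, map_sum, Derivation.leibniz,
    smul_eq_mul, ← Finset.sum_add_distrib]
  exact Finset.sum_congr rfl fun k _ => by ring

theorem entrywise_transpose (D : Derivation ℝ A A) (P : Matrix ι ι A) :
    entrywise D P.transpose = (entrywise D P).transpose := rfl

theorem entrywise_one [DecidableEq ι] (D : Derivation ℝ A A) :
    entrywise D (1 : Matrix ι ι A) = 0 := by
  ext i j
  by_cases h : i = j <;> simp [h]

theorem entrywise_inv [Fintype ι] [DecidableEq ι] (D : Derivation ℝ A A)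
    {P Q : Matrix ι ι A} (h : P * Q = 1) :
    entrywise D Q = -(Q * entrywise D P * Q) := by
  have h' : Q * P = 1 := mul_eq_one_comm.mp h
  have := congrArg (Q * ·) ((entrywise_mul D P Q).symm.trans (by rw [h, entrywise_one]))
  simp only [mul_add, mul_zero, ← mul_assoc, h', one_mul] at this
  exact eq_neg_of_add_eq_zero_right this

theorem entrywise_comm {d : ι → Derivation ℝ A A}
    (hd : ∀ i j x, d i (d j x) = d j (d i x)) (i j : ι) (P : Matrix ι ι A) :
    entrywise (d i) (entrywise (d j) P) = entrywise (d j) (entrywise (d i) P) := by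
  ext a b; exact hd i j _

theorem inverse_symm {B : Type*} [CommRing B] [Fintype ι] [DecidableEq ι] {g Q : Matrix ι ι B}
    (hg : g.IsSymm) (hgQ : g * Q = 1) : Q.transpose = Q := by
  have h : Q.transpose * g = 1 := by
    rw [← hg.eq, ← Matrix.transpose_mul, hgQ, Matrix.transpose_one]
  calc Q.transpose = Q.transpose * (g * Q) := by rw [hgQ, mul_one]
    _ = Q := by rw [← mul_assoc, h, one_mul]

theorem two_half_smul (x : A) : (1 / 2 : ℝ) • x + (1 / 2 : ℝ) • x = x := by
  rw [← add_smul]; norm_num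

variable [Fintype ι]

/-- The Christoffel symbols `Γ^k_{ij}` of the metric `g` with inverse `Q`, where the derivations
`d i` play the role of the partial derivatives. -/
noncomputable def chr (d : ι → Derivation ℝ A A) (g Q : Matrix ι ι A) (k i j : ι) : A :=
  (1 / 2 : ℝ) • ∑ l, Q k l * (d i (g j l) + d j (g i l) - d l (g i j))

/-- The connection matrices `(Γ_i)^k_l = Γ^k_{il}`. -/
noncomputable def conn (d : ι → Derivation ℝ A A) (g Q : Matrix ι ι A) (i : ι) : Matrix ι ι A :=
  Matrix.of fun k l => chr d g Q k i l

/-- The curvature matrices `F_{ij} = ∂_i Γ_j - ∂_j Γ_i + [Γ_i, Γ_j]` of the connection. -/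
noncomputable def curv (d : ι → Derivation ℝ A A) (g Q : Matrix ι ι A) (i j : ι) :
    Matrix ι ι A :=
  entrywise (d i) (conn d g Q j) - entrywise (d j) (conn d g Q i)
    + conn d g Q i * conn d g Q j - conn d g Q j * conn d g Q i

/-- The Ricci tensor `R_{ij} = (F_{kj})^k_i`. -/
noncomputable def ric (d : ι → Derivation ℝ A A) (g Q : Matrix ι ι A) : Matrix ι ι A :=
  Matrix.of fun i j => ∑ k, curv d g Q k j k i

/-- The covariant derivative `S_{ij|k}` of a covariant 2-tensor. -/
noncomputable def cov (d : ι → Derivation ℝ A A) (g Q S : Matrix ι ι A) (i j k : ι) : A :=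
  d k (S i j) - ∑ l, chr d g Q l k i * S l j - ∑ l, chr d g Q l k j * S i l

/-- The covariant derivative `∇_a F_{ij}` of the curvature, as a matrix in the remaining two
indices. -/
noncomputable def covCurv (d : ι → Derivation ℝ A A) (g Q : Matrix ι ι A) (a i j : ι) :
    Matrix ι ι A :=
  entrywise (d a) (curv d g Q i j) + conn d g Q a * curv d g Q i j
    - curv d g Q i j * conn d g Q a
    - ∑ p, (chr d g Q p a i • curv d g Q p j + chr d g Q p a j • curv d g Q i p)

variable {d : ι → Derivation ℝ A A} {g Q : Matrix ι ι A}

theorem chr_symm (hg : g.IsSymm) (k i j : ι) : chr d g Q k i j = chr d g Q k j i := by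
  unfold chr
  refine congrArg _ (Finset.sum_congr rfl fun l _ => ?_)
  rw [hg.apply i j]
  ring

/-- The Christoffel symbols of the first kind, with the upper index lowered. -/
theorem sum_mul_chr [DecidableEq ι] (hgQ : g * Q = 1) (a i j : ι) :
    ∑ k, g a k * chr d g Q k i j
      = (1 / 2 : ℝ) • (d i (g j a) + d j (g i a) - d a (g i j)) := by
  have key : ∀ v : ι → A, ∑ k, g a k * ∑ l, Q k l * v l = v a := fun v => by
    have := congrFun (Matrix.mulVec_mulVec v g Q) a
    rw [hgQ, Matrix.one_mulVec] at this
    simpa [Matrix.mulVec, dotProduct] using this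
  simp only [chr, mul_smul_comm, ← Finset.smul_sum]
  rw [key fun l => d i (g j l) + d j (g i l) - d l (g i j)]

/-- Compatibility of the connection with the metric. -/
theorem entrywise_metric [DecidableEq ι] (hg : g.IsSymm) (hgQ : g * Q = 1) (k : ι) :
    entrywise (d k) g = (conn d g Q k).transpose * g + g * conn d g Q k := by
  ext i j
  have h1 := sum_mul_chr (d := d) hgQ i k j
  have h2 := sum_mul_chr (d := d) hgQ j k i
  have h3 : ∑ l, chr d g Q l k i * g l j = ∑ l, g j l * chr d g Q l k i :=
    Finset.sum_congr rfl fun l _ => by rw [hg.apply l j]; ring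
  simp only [Matrix.add_apply, Matrix.mul_apply, conn, Matrix.transpose_apply, Matrix.of_apply,
    entrywise_apply, h3, h1, h2]
  rw [← smul_add, hg.apply i j]
  nth_rewrite 1 [← two_half_smul (d k (g i j))]
  rw [← smul_add]
  congr 1
  ring

/-- The inverse metric is parallel. -/
theorem entrywise_inverse [DecidableEq ι] (hg : g.IsSymm) (hgQ : g * Q = 1) (k : ι) :
    entrywise (d k) Q = -(conn d g Q k * Q + Q * (conn d g Q k).transpose) := by
  have hQg : Q * g = 1 := mul_eq_one_comm.mp hgQ
  rw [entrywise_inv (d k) hgQ, entrywise_metric hg hgQ, mul_add, add_mul,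
    ← mul_assoc, ← mul_assoc, hQg, one_mul, mul_assoc _ g Q, hgQ, mul_one, add_comm]

theorem curv_swap (i j : ι) : curv d g Q i j = -curv d g Q j i := by
  unfold curv; abel

/-- With both matrix indices raised, the curvature is skew: commuting derivatives applied to the
inverse metric, which is parallel. -/
theorem curv_mul_inverse_skew [DecidableEq ι]
    (hd : ∀ i j x, d i (d j x) = d j (d i x)) (hg : g.IsSymm)
    (hgQ : g * Q = 1) (i j : ι) :
    (curv d g Q i j * Q).transpose = -(curv d g Q i j * Q) := by
  have h := entrywise_comm hd i j Q
  rw [entrywise_inverse hg hgQ, entrywise_inverse hg hgQ, map_neg, map_neg, map_add, map_add,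
    entrywise_mul, entrywise_mul, entrywise_mul, entrywise_mul, entrywise_inverse hg hgQ,
    entrywise_inverse hg hgQ, entrywise_transpose, entrywise_transpose] at h
  rw [Matrix.transpose_mul, inverse_symm hg hgQ, curv]
  simp only [Matrix.transpose_add, Matrix.transpose_sub, Matrix.transpose_mul]
  rw [← sub_eq_zero] at h ⊢
  rw [← neg_eq_zero, ← h]
  noncomm_ring

theorem covCurv_mul_inverse [DecidableEq ι] (hg : g.IsSymm) (hgQ : g * Q = 1) (a i j : ι) :
    covCurv d g Q a i j * Q
      = entrywise (d a) (curv d g Q i j * Q) + conn d g Q a * (curv d g Q i j * Q)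
        + (curv d g Q i j * Q) * (conn d g Q a).transpose
        - ∑ p, (chr d g Q p a i • (curv d g Q p j * Q)
          + chr d g Q p a j • (curv d g Q i p * Q)) := by
  rw [covCurv, sub_mul, Finset.sum_mul, entrywise_mul, entrywise_inverse hg hgQ]
  simp only [add_mul, Matrix.smul_mul]
  noncomm_ring

/-- Skewness of the curvature with raised index is inherited by its covariant derivative, the
inverse metric being parallel. -/
theorem covCurv_mul_inverse_skew [DecidableEq ι]
    (hd : ∀ i j x, d i (d j x) = d j (d i x)) (hg : g.IsSymm)
    (hgQ : g * Q = 1) (a i j : ι) :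
    (covCurv d g Q a i j * Q).transpose = -(covCurv d g Q a i j * Q) := by
  have hs := curv_mul_inverse_skew hd hg hgQ
  rw [covCurv_mul_inverse hg hgQ, Matrix.transpose_sub, Matrix.transpose_add,
    Matrix.transpose_add, ← entrywise_transpose, Matrix.transpose_mul (conn d g Q a),
    Matrix.transpose_mul (curv d g Q i j * Q), Matrix.transpose_transpose, Matrix.transpose_sum]
  simp only [Matrix.transpose_add, Matrix.transpose_smul, hs, map_neg, smul_neg]
  rw [← sub_eq_zero]
  have : ∑ x, (-(chr d g Q x a i • (curv d g Q x j * Q))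
        + -(chr d g Q x a j • (curv d g Q i x * Q)))
      = -∑ x, (chr d g Q x a i • (curv d g Q x j * Q)
        + chr d g Q x a j • (curv d g Q i x * Q)) := by
    rw [← Finset.sum_neg_distrib]
    exact Finset.sum_congr rfl fun p _ => by abel
  rw [this]
  noncomm_ring

theorem covCurv_swap [DecidableEq ι] (a i j : ι) : covCurv d g Q a i j = -covCurv d g Q a j i := by
  have : ∑ p, (chr d g Q p a i • curv d g Q p j + chr d g Q p a j • curv d g Q i p)
      = -∑ p, (chr d g Q p a j • curv d g Q p i + chr d g Q p a i • curv d g Q j p) := by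
    rw [← Finset.sum_neg_distrib]
    refine Finset.sum_congr rfl fun p _ => ?_
    rw [curv_swap p j, curv_swap i p, smul_neg, smul_neg]
    abel
  rw [covCurv, covCurv, this, curv_swap i j, map_neg]
  noncomm_ring

/-- The second Bianchi identity. -/
theorem bianchi [DecidableEq ι] (hd : ∀ i j x, d i (d j x) = d j (d i x)) (hg : g.IsSymm)
    (a i j : ι) :
    covCurv d g Q a i j + covCurv d g Q i j a + covCurv d g Q j a i = 0 := by
  -- The connection terms in the indices `a i j` cancel because the connection is torsion free.
  have hs : ∑ p, (chr d g Q p a i • curv d g Q p j + chr d g Q p a j • curv d g Q i p)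
      + ∑ p, (chr d g Q p i j • curv d g Q p a + chr d g Q p i a • curv d g Q j p)
      + ∑ p, (chr d g Q p j a • curv d g Q p i + chr d g Q p j i • curv d g Q a p) = 0 := by
    rw [← Finset.sum_add_distrib, ← Finset.sum_add_distrib]
    refine Finset.sum_eq_zero fun p _ => ?_
    rw [curv_swap j p, curv_swap i p, curv_swap a p, chr_symm hg p i a, chr_symm hg p j a,
      chr_symm hg p j i]
    simp only [smul_neg]
    abel
  have hm : ∀ a i j : ι, entrywise (d a) (curv d g Q i j)
      = entrywise (d a) (entrywise (d i) (conn d g Q j))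
        - entrywise (d a) (entrywise (d j) (conn d g Q i))
        + (entrywise (d a) (conn d g Q i) * conn d g Q j
          + conn d g Q i * entrywise (d a) (conn d g Q j))
        - (entrywise (d a) (conn d g Q j) * conn d g Q i
          + conn d g Q j * entrywise (d a) (conn d g Q i)) := fun a i j => by
    rw [curv, map_sub, map_add, map_sub, entrywise_mul, entrywise_mul]
  have hcov : ∀ x y z s t u : Matrix ι ι A, s + t + u = 0 → x + y + z = 0 →
      (x - s) + (y - t) + (z - u) = 0 := fun x y z s t u h1 h2 => by
    rw [← sub_eq_zero.mpr (h2.trans h1.symm)]; abel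
  refine hcov _ _ _ _ _ _ hs ?_
  rw [hm, hm, hm, entrywise_comm hd i a, entrywise_comm hd j i, entrywise_comm hd j a]
  simp only [curv]
  noncomm_ring

/-- The contraction of `∇_a F_{kj}` defining the Ricci tensor commutes with the covariant
derivative: the connection terms of the two contracted indices cancel. -/
theorem sum_covCurv (a j l : ι) :
    ∑ k, covCurv d g Q a k j k l = cov d g Q (ric d g Q) l j a := by
  have h1 : ∑ k, ∑ p, chr d g Q k a p * curv d g Q k j p l
      = ∑ k, ∑ p, chr d g Q p a k * curv d g Q p j k l := Finset.sum_comm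
  have h2 : ∑ k, ∑ p, curv d g Q k j k p * chr d g Q p a l
      = ∑ p, chr d g Q p a l * ∑ k, curv d g Q k j k p := by
    rw [Finset.sum_comm]
    refine Finset.sum_congr rfl fun p _ => ?_
    rw [Finset.mul_sum]
    exact Finset.sum_congr rfl fun k _ => mul_comm _ _
  have h3 : ∑ k, ∑ p, chr d g Q p a j * curv d g Q k p k l
      = ∑ p, chr d g Q p a j * ∑ k, curv d g Q k p k l := by
    rw [Finset.sum_comm]
    exact Finset.sum_congr rfl fun p _ => (Finset.mul_sum _ _ _).symm
  simp only [covCurv, cov, ric, conn, Matrix.add_apply, Matrix.sub_apply, Matrix.mul_apply,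
    Matrix.sum_apply, Matrix.smul_apply, Matrix.of_apply, smul_eq_mul, entrywise_apply,
    Finset.sum_add_distrib, Finset.sum_sub_distrib, map_sum]
  rw [h1, h2, h3]
  ring

/-- The contracted second Bianchi identity `2 g^{lk} R_{lj|k} = g^{lk} R_{lk|j}`. Skewness of
`covCurv * Q` turns the divergence of the curvature into a divergence of the Ricci tensor, so that
the symmetry of the Riemann tensor under exchange of pairs is not needed. -/
theorem contracted_bianchi [DecidableEq ι] (hd : ∀ i j x, d i (d j x) = d j (d i x)) (hg : g.IsSymm)
    (hgQ : g * Q = 1) (j : ι) :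
    2 * ∑ l, ∑ k, Q l k * cov d g Q (ric d g Q) l j k
      = ∑ l, ∑ k, Q l k * cov d g Q (ric d g Q) l k j := by
  -- The second Bianchi identity, contracted over the upper index of the curvature.
  have hb : ∀ l a, cov d g Q (ric d g Q) l j a + ∑ k, covCurv d g Q k j a k l
      - cov d g Q (ric d g Q) l a j = 0 := fun l a => by
    rw [← sum_covCurv, ← sum_covCurv, ← Finset.sum_add_distrib, ← Finset.sum_sub_distrib]
    refine Finset.sum_eq_zero fun k _ => ?_
    have := congrFun (congrFun (bianchi (Q := Q) hd hg a k j) k) l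
    rw [covCurv_swap j a k] at this
    simpa [sub_eq_add_neg] using this
  have hdiv : ∑ l, ∑ a, Q l a * ∑ k, covCurv d g Q k j a k l
      = ∑ l, ∑ k, Q l k * cov d g Q (ric d g Q) l j k := by
    have hskew : ∀ k a, ∑ l, covCurv d g Q k j a k l * Q l a
        = ∑ l, covCurv d g Q k a j a l * Q l k := fun k a => by
      have := congrFun (congrFun (covCurv_mul_inverse_skew hd hg hgQ k j a) a) k
      rw [Matrix.transpose_apply, covCurv_swap k j a] at this
      rw [covCurv_swap k j a]
      simpa [Matrix.mul_apply] using this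
    calc ∑ l, ∑ a, Q l a * ∑ k, covCurv d g Q k j a k l
        = ∑ k, ∑ a, ∑ l, covCurv d g Q k j a k l * Q l a := by
          simp only [Finset.mul_sum]
          rw [Finset.sum_comm]
          refine Eq.trans (Finset.sum_congr rfl fun a _ => Finset.sum_comm) ?_
          rw [Finset.sum_comm]
          exact Finset.sum_congr rfl fun k _ => Finset.sum_congr rfl fun a _ =>
            Finset.sum_congr rfl fun l _ => mul_comm _ _
      _ = ∑ k, ∑ a, ∑ l, covCurv d g Q k a j a l * Q l k := by simp only [hskew]
      _ = ∑ l, ∑ k, Q l k * cov d g Q (ric d g Q) l j k := by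
          simp only [← sum_covCurv, Finset.mul_sum]
          refine Eq.trans (Finset.sum_congr rfl fun k _ => Finset.sum_comm) ?_
          rw [Finset.sum_comm]
          exact Finset.sum_congr rfl fun l _ => Finset.sum_congr rfl fun k _ =>
            Finset.sum_congr rfl fun a _ => mul_comm _ _
  have h0 : ∑ l, ∑ a, Q l a * (cov d g Q (ric d g Q) l j a + ∑ k, covCurv d g Q k j a k l
      - cov d g Q (ric d g Q) l a j) = 0 := by simp [hb]
  simp only [mul_sub, mul_add, Finset.sum_sub_distrib, Finset.sum_add_distrib] at h0
  rw [hdiv] at h0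
  linear_combination h0

/-- The variation `½ g^{kl} (v_{jl|i} + v_{il|j} - v_{ij|l})` of the Christoffel symbols under the
variation `v = D g` of the metric. -/
theorem derivation_chr [DecidableEq ι] (D : Derivation ℝ A A) (hD : ∀ i x, D (d i x) = d i (D x))
    (hg : g.IsSymm) (hgQ : g * Q = 1) (k i j : ι) :
    D (chr d g Q k i j) = (1 / 2 : ℝ) • ∑ l, Q k l *
      (cov d g Q (entrywise D g) j l i + cov d g Q (entrywise D g) i l j
        - cov d g Q (entrywise D g) i j l) := by
  have hQg : Q * g = 1 := mul_eq_one_comm.mp hgQ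
  have hV : ∀ a b, D (g a b) = D (g b a) := fun a b => by rw [hg.apply]
  -- The derivative of `sum_mul_chr`; the connection terms of the three covariant derivatives
  -- combine to the term `v_{ab} Γ^b_{ij}` coming from the product rule.
  have hlow : ∀ a, ∑ b, g a b * D (chr d g Q b i j)
      = (1 / 2 : ℝ) • (cov d g Q (entrywise D g) j a i + cov d g Q (entrywise D g) i a j
        - cov d g Q (entrywise D g) i j a) := fun a => by
    have h := congrArg D (sum_mul_chr (d := d) hgQ a i j)
    simp only [map_sum, Derivation.leibniz, smul_eq_mul, Finset.sum_add_distrib,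
      Derivation.map_smul,
      map_add, map_sub, hD] at h
    rw [eq_sub_of_add_eq h, cov, cov, cov]
    simp only [entrywise_apply]
    have e1 : ∀ a b c : ι, ∑ l, chr d g Q l a b * D (g c l) = ∑ l, chr d g Q l a b * D (g l c) :=
      fun a b c => Finset.sum_congr rfl fun l _ => by rw [hV]
    have e2 : ∀ a b c : ι, ∑ l, chr d g Q l a b * D (g c l) = ∑ l, chr d g Q l b a * D (g c l) :=
      fun a b c => Finset.sum_congr rfl fun l _ => by rw [chr_symm hg]
    rw [← e1 i j a, ← e1 j i a, ← e1 a i j, e2 a j i, e2 a i j, e2 j i a]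
    rw [← sub_eq_zero]
    generalize ∑ l, chr d g Q l i j * D (g a l) = S
    nth_rewrite 1 [← two_half_smul S]
    rw [← smul_add, ← smul_sub, ← smul_sub]
    refine Eq.trans (congrArg _ ?_) (smul_zero (1 / 2 : ℝ))
    ring
  calc D (chr d g Q k i j) = ∑ a, Q k a * ∑ b, g a b * D (chr d g Q b i j) := by
        have := congrFun (Matrix.mulVec_mulVec (fun b => D (chr d g Q b i j)) Q g) k
        rw [hQg, Matrix.one_mulVec] at this
        simpa [Matrix.mulVec, dotProduct] using this.symm
    _ = _ := by simp only [hlow, mul_smul_comm, ← Finset.smul_sum]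

theorem cov_smul (c : ℝ) (S : Matrix ι ι A) (i j k : ι) :
    cov d g Q (c • S) i j k = c • cov d g Q S i j k := by
  simp only [cov, Matrix.smul_apply, Derivation.map_smul, mul_smul_comm, ← Finset.smul_sum,
    smul_sub]

end Formal

/-! ### The differential algebra of smooth functions on a subset of a normed space -/

section SmoothFunctions

/-- The extension by zero to the whole space of a function on `Ω`. -/
noncomputable def zeroExtend {V : Type*} {Ω : Set V} (f : Ω → ℝ) : V → ℝ :=
  Function.extend Subtype.val f 0

theorem zeroExtend_apply {V : Type*} {Ω : Set V} (f : Ω → ℝ) (x : Ω) : zeroExtend f x = f x :=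
  Subtype.val_injective.extend_apply _ _ _

variable {V : Type*} [NormedAddCommGroup V] [NormedSpace ℝ V]

theorem contDiffOn_zeroExtend_iff {Ω : Set V} {f : Ω → ℝ} {F : V → ℝ} (h : ∀ x : Ω, f x = F x) :
    ContDiffOn ℝ ∞ (zeroExtend f) Ω ↔ ContDiffOn ℝ ∞ F Ω :=
  contDiffOn_congr fun x hx => (zeroExtend_apply f ⟨x, hx⟩).trans (h ⟨x, hx⟩)

/-- The algebra of smooth functions on a subset `Ω` of a normed space, as functions on the
subtype. Smoothness within `Ω` does not depend on the values outside `Ω`, so it can be tested on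
the extension by zero. -/
def smoothOn (Ω : Set V) : Subalgebra ℝ (Ω → ℝ) where
  carrier := {f | ContDiffOn ℝ ∞ (zeroExtend f) Ω}
  mul_mem' {a b} ha hb := (contDiffOn_zeroExtend_iff
    fun x => by simp [zeroExtend_apply]).mpr (ContDiffOn.mul ha hb)
  add_mem' {a b} ha hb := (contDiffOn_zeroExtend_iff
    fun x => by simp [zeroExtend_apply]).mpr (ContDiffOn.add ha hb)
  algebraMap_mem' r := (contDiffOn_zeroExtend_iff (F := fun _ => r) fun _ => rfl).mpr
    contDiffOn_const

namespace smoothOn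

variable {Ω : Set V}

theorem contDiffOn (a : smoothOn Ω) : ContDiffOn ℝ ∞ (zeroExtend a.1) Ω := a.2

/-- A smooth function on the whole space, restricted to `Ω`. -/
def mk (F : V → ℝ) (hF : ContDiffOn ℝ ∞ F Ω) : smoothOn Ω :=
  ⟨fun x => F x, (contDiffOn_zeroExtend_iff fun _ => rfl).mpr hF⟩

/-- Evaluation at a point of `Ω`. -/
def evalAt (x : V) (hx : x ∈ Ω) : smoothOn Ω →ₐ[ℝ] ℝ :=
  (Pi.evalAlgHom ℝ (fun _ : Ω => ℝ) ⟨x, hx⟩).comp (smoothOn Ω).val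

theorem evalAt_mk (F : V → ℝ) (hF : ContDiffOn ℝ ∞ F Ω) (x : V) (hx : x ∈ Ω) :
    evalAt x hx (mk F hF) = F x := rfl

theorem zeroExtend_eq_evalAt (a : smoothOn Ω) (x : V) (hx : x ∈ Ω) :
    zeroExtend a.1 x = evalAt x hx a := zeroExtend_apply a.1 ⟨x, hx⟩

theorem ext_evalAt {a b : smoothOn Ω} (h : ∀ x hx, evalAt x hx a = evalAt x hx b) : a = b :=
  Subtype.ext (funext fun x => h x.1 x.2)

theorem isUnit_of_evalAt_ne_zero (a : smoothOn Ω) (h : ∀ x hx, evalAt x hx a ≠ 0) : IsUnit a := by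
  have hi : ContDiffOn ℝ ∞ (fun x => (zeroExtend a.1 x)⁻¹) Ω :=
    (smoothOn.contDiffOn a).inv fun x hx => by rw [zeroExtend_eq_evalAt a x hx]; exact h x hx
  refine IsUnit.of_mul_eq_one (mk _ hi) (ext_evalAt fun x hx => ?_)
  rw [map_mul, evalAt_mk, zeroExtend_eq_evalAt a x hx, map_one, mul_inv_cancel₀ (h x hx)]

/-- The directional derivative within `Ω`, as a derivation of the algebra of smooth functions. -/
noncomputable def dirDeriv (hΩ : UniqueDiffOn ℝ Ω) (v : V) :
    Derivation ℝ (smoothOn Ω) (smoothOn Ω) :=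
  Derivation.mk' (R := ℝ)
    { toFun := fun a => mk (fun x => fderivWithin ℝ (zeroExtend a.1) Ω x v)
        (((smoothOn.contDiffOn a).fderivWithin hΩ (m := ∞) (by simp)).clm_apply contDiffOn_const)
      map_add' := fun a b => ext_evalAt fun x hx => by
        have ha := ((smoothOn.contDiffOn a) x hx).differentiableWithinAt (by simp)
        have hb := ((smoothOn.contDiffOn b) x hx).differentiableWithinAt (by simp)
        rw [map_add, evalAt_mk, evalAt_mk, evalAt_mk,
          fderivWithin_congr' (f := zeroExtend a.1 + zeroExtend b.1) (fun z hz => by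
            rw [Pi.add_apply, zeroExtend_eq_evalAt _ z hz, zeroExtend_eq_evalAt _ z hz,
              zeroExtend_eq_evalAt _ z hz, map_add]) hx,
          fderivWithin_add (hΩ x hx) ha hb]
        rfl
      map_smul' := fun c a => ext_evalAt fun x hx => by
        have ha := ((smoothOn.contDiffOn a) x hx).differentiableWithinAt (by simp)
        rw [RingHom.id_apply, map_smul, evalAt_mk, evalAt_mk,
          fderivWithin_congr' (f := c • zeroExtend a.1) (fun z hz => by
            rw [Pi.smul_apply, zeroExtend_eq_evalAt _ z hz, zeroExtend_eq_evalAt _ z hz,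
              map_smul]) hx,
          fderivWithin_const_smul (hΩ x hx) ha]
        rfl }
    fun a b => ext_evalAt fun x hx => by
      have ha := ((smoothOn.contDiffOn a) x hx).differentiableWithinAt (by simp)
      have hb := ((smoothOn.contDiffOn b) x hx).differentiableWithinAt (by simp)
      simp only [LinearMap.coe_mk, AddHom.coe_mk, smul_eq_mul, map_add, map_mul, evalAt_mk]
      rw [fderivWithin_congr' (f := zeroExtend a.1 * zeroExtend b.1) (fun z hz => by
            rw [Pi.mul_apply, zeroExtend_eq_evalAt _ z hz, zeroExtend_eq_evalAt _ z hz,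
              zeroExtend_eq_evalAt _ z hz, map_mul]) hx,
          fderivWithin_mul (hΩ x hx) ha hb]
      simp [zeroExtend_eq_evalAt _ x hx]

theorem evalAt_dirDeriv (hΩ : UniqueDiffOn ℝ Ω) (v : V) (a : smoothOn Ω) (x : V) (hx : x ∈ Ω) :
    evalAt x hx (dirDeriv hΩ v a) = fderivWithin ℝ (zeroExtend a.1) Ω x v := rfl

theorem dirDeriv_comm (hΩ : UniqueDiffOn ℝ Ω) (hΩ' : Ω ⊆ closure (interior Ω)) (v w : V)
    (a : smoothOn Ω) :
    dirDeriv hΩ v (dirDeriv hΩ w a) = dirDeriv hΩ w (dirDeriv hΩ v a) := by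
  refine ext_evalAt fun x hx => ?_
  have key : ∀ v w : V, evalAt x hx (dirDeriv hΩ v (dirDeriv hΩ w a))
      = fderivWithin ℝ (fderivWithin ℝ (zeroExtend a.1) Ω) Ω x v w := fun v w => by
    have hd : DifferentiableWithinAt ℝ (fderivWithin ℝ (zeroExtend a.1) Ω) Ω x :=
      (((smoothOn.contDiffOn a).fderivWithin hΩ (m := ∞) (by simp)) x hx).differentiableWithinAt
        (by simp)
    rw [evalAt_dirDeriv, fderivWithin_congr' (f := fun z => fderivWithin ℝ (zeroExtend a.1) Ω z w)
      (fun z hz => by rw [zeroExtend_eq_evalAt _ z hz, evalAt_dirDeriv]) hx,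
      fderivWithin_clm_apply (hΩ x hx) hd (differentiableWithinAt_const w)]
    simp
  rw [key, key]
  exact ((smoothOn.contDiffOn a) x hx).isSymmSndFDerivWithinAt
    (by rw [minSmoothness_of_isRCLikeNormedField]; exact ENat.LEInfty.out) hΩ (hΩ' hx) hx v w

end smoothOn

end SmoothFunctions

/-! ### Coordinate expressions in the algebra of smooth functions on space-time -/

section SpaceTime

open smoothOn Formal

variable {m : ℕ} {T : ℝ} {D : Set (EuclideanSpace ℝ (Fin (m + 1)))}

/-- The partial derivative within the half space, at a fixed time, is a directional derivative
within `(0, T) × D`. -/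
theorem pd_eq_evalAt (hΩ : UniqueDiffOn ℝ (Set.Ioo 0 T ×ˢ D))
    (hD : ∀ y ∈ D, D ∈ nhdsWithin y (Set.range (𝓡∂ (m + 1))))
    (hDr : D ⊆ Set.range (𝓡∂ (m + 1)))
    {t : ℝ} (ht : t ∈ Set.Ioo 0 T) {y : EuclideanSpace ℝ (Fin (m + 1))} (hy : y ∈ D)
    (k : Fin (m + 1)) (a : smoothOn (Set.Ioo 0 T ×ˢ D)) {f : EuclideanSpace ℝ (Fin (m + 1)) → ℝ}
    (hf : ∀ z (hz : z ∈ D), f z = evalAt (t, z) (Set.mk_mem_prod ht hz) a) :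
    pd k f y
      = evalAt (t, y) (Set.mk_mem_prod ht hy) (dirDeriv hΩ (0, EuclideanSpace.single k 1) a) := by
  have ha : HasFDerivWithinAt (zeroExtend a.1) _ (Set.Ioo 0 T ×ˢ D) (t, y) :=
    (((smoothOn.contDiffOn a) (t, y) ⟨ht, hy⟩).differentiableWithinAt (by simp)).hasFDerivWithinAt
  have hc : HasFDerivWithinAt (fun z => zeroExtend a.1 (t, z)) _ D y :=
    ha.comp y (hasFDerivAt_prodMk_right t y).hasFDerivWithinAt fun z hz => Set.mk_mem_prod ht hz
  have hf' : HasFDerivWithinAt f _ D y := hc.congr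
    (fun z hz => (hf z hz).trans (zeroExtend_eq_evalAt a (t, z) (Set.mk_mem_prod ht hz)).symm)
    ((hf y hy).trans (zeroExtend_eq_evalAt a (t, y) (Set.mk_mem_prod ht hy)).symm)
  rw [pd, (hf'.mono_of_mem_nhdsWithin (hD y hy)).fderivWithin
    ((𝓡∂ (m + 1)).uniqueDiffOn y (hDr hy)), evalAt_dirDeriv]
  simp

theorem hasDerivAt_evalAt (hΩ : UniqueDiffOn ℝ (Set.Ioo 0 T ×ˢ D))
    {t : ℝ} (ht : t ∈ Set.Ioo 0 T) {y : EuclideanSpace ℝ (Fin (m + 1))} (hy : y ∈ D)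
    (a : smoothOn (Set.Ioo 0 T ×ˢ D)) {f : ℝ → ℝ}
    (hf : ∀ s (hs : s ∈ Set.Ioo 0 T), f s = evalAt (s, y) (Set.mk_mem_prod hs hy) a) :
    HasDerivAt f (evalAt (t, y) (Set.mk_mem_prod ht hy) (dirDeriv hΩ (1, 0) a)) t := by
  have ha : HasFDerivWithinAt (zeroExtend a.1) _ (Set.Ioo 0 T ×ˢ D) (t, y) :=
    (((smoothOn.contDiffOn a) (t, y) ⟨ht, hy⟩).differentiableWithinAt (by simp)).hasFDerivWithinAt
  have hc : HasFDerivWithinAt (fun s => zeroExtend a.1 (s, y)) _ (Set.Ioo 0 T) t :=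
    ha.comp t (hasFDerivAt_prodMk_left t y).hasFDerivWithinAt fun s hs => Set.mk_mem_prod hs hy
  have hf' : HasFDerivWithinAt f _ (Set.Ioo 0 T) t := hc.congr
    (fun s hs => (hf s hs).trans (zeroExtend_eq_evalAt a (s, y) (Set.mk_mem_prod hs hy)).symm)
    ((hf t ht).trans (zeroExtend_eq_evalAt a (t, y) (Set.mk_mem_prod ht hy)).symm)
  have := (hf'.hasFDerivAt (isOpen_Ioo.mem_nhds ht)).hasDerivAt
  rw [evalAt_dirDeriv]
  simpa using this

/-- The coordinate derivations `∂_k` of the smooth functions on `(0, T) × D`. -/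
noncomputable abbrev spaceDeriv (hΩ : UniqueDiffOn ℝ (Set.Ioo 0 T ×ˢ D)) (k : Fin (m + 1)) :
    Derivation ℝ (smoothOn (Set.Ioo 0 T ×ˢ D)) (smoothOn (Set.Ioo 0 T ×ˢ D)) :=
  dirDeriv hΩ (0, EuclideanSpace.single k 1)

section Compare

variable (hΩ : UniqueDiffOn ℝ (Set.Ioo 0 T ×ˢ D))
  (hD : ∀ y ∈ D, D ∈ nhdsWithin y (Set.range (𝓡∂ (m + 1))))
  (hDr : D ⊆ Set.range (𝓡∂ (m + 1)))
  {a Q : Matrix (Fin (m + 1)) (Fin (m + 1)) (smoothOn (Set.Ioo 0 T ×ˢ D))} (haQ : a * Q = 1)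
  {t : ℝ} (ht : t ∈ Set.Ioo 0 T) {G : Field2 m}
  (hG : ∀ z (hz : z ∈ D) i j, G z i j = evalAt (t, z) (Set.mk_mem_prod ht hz) (a i j))

include haQ hG

theorem inv_eq_evalAt {y : EuclideanSpace ℝ (Fin (m + 1))} (hy : y ∈ D) (i j : Fin (m + 1)) :
    (G y)⁻¹ i j = evalAt (t, y) (Set.mk_mem_prod ht hy) (Q i j) := by
  have hGy : G y = (evalAt (t, y) (Set.mk_mem_prod ht hy)).mapMatrix a := by
    ext i j; exact hG y hy i j
  have h := congrArg (evalAt (t, y) (Set.mk_mem_prod ht hy)).mapMatrix haQ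
  rw [map_mul, map_one, ← hGy] at h
  rw [Matrix.inv_eq_right_inv h]
  rfl

include hD hDr

theorem christoffel_eq_evalAt {y : EuclideanSpace ℝ (Fin (m + 1))} (hy : y ∈ D)
    (k i j : Fin (m + 1)) :
    christoffel G k i j y
      = evalAt (t, y) (Set.mk_mem_prod ht hy) (chr (spaceDeriv hΩ) a Q k i j) := by
  have hpd : ∀ k i j, pd k (fun z => G z i j) y
      = evalAt (t, y) (Set.mk_mem_prod ht hy) (spaceDeriv hΩ k (a i j)) := fun k i j =>
    pd_eq_evalAt hΩ hD hDr ht hy k (a i j) fun z hz => hG z hz i j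
  simp only [christoffel, chr, map_smul, map_sum, map_mul, map_add, map_sub, hpd,
    inv_eq_evalAt haQ ht hG hy, smul_eq_mul]

theorem ricci_eq_evalAt (ha : a.IsSymm) {y : EuclideanSpace ℝ (Fin (m + 1))} (hy : y ∈ D)
    (i j : Fin (m + 1)) :
    ricci G y i j = evalAt (t, y) (Set.mk_mem_prod ht hy) (ric (spaceDeriv hΩ) a Q i j) := by
  have hsymm : ∀ l k, chr (spaceDeriv hΩ) a Q l k i = chr (spaceDeriv hΩ) a Q l i k :=
    fun l k => chr_symm ha l k i
  have hpd : ∀ l k i j, pd l (christoffel G k i j) y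
      = evalAt (t, y) (Set.mk_mem_prod ht hy) (spaceDeriv hΩ l (chr (spaceDeriv hΩ) a Q k i j)) :=
    fun l k i j =>
    pd_eq_evalAt hΩ hD hDr ht hy l _ fun z hz => christoffel_eq_evalAt hΩ hD hDr haQ ht hG hz k i j
  simp only [ricci, ric, curv, conn, Matrix.of_apply, map_sum, hpd,
    christoffel_eq_evalAt hΩ hD hDr haQ ht hG hy, Matrix.add_apply, Matrix.sub_apply,
    entrywise_apply, Matrix.mul_apply, map_add, map_sub, map_mul, Finset.sum_add_distrib,
    Finset.sum_sub_distrib, hsymm]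
  ring

theorem covDeriv_eq_evalAt {y : EuclideanSpace ℝ (Fin (m + 1))} (hy : y ∈ D) {S : Field2 m}
    {b : Matrix (Fin (m + 1)) (Fin (m + 1)) (smoothOn (Set.Ioo 0 T ×ˢ D))}
    (hS : ∀ z (hz : z ∈ D) i j, S z i j = evalAt (t, z) (Set.mk_mem_prod ht hz) (b i j))
    (i j k : Fin (m + 1)) :
    covDeriv G S i j k y
      = evalAt (t, y) (Set.mk_mem_prod ht hy) (cov (spaceDeriv hΩ) a Q b i j k) := by
  simp only [covDeriv, cov, map_sub, map_sum, map_mul,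
    christoffel_eq_evalAt hΩ hD hDr haQ ht hG hy, hS y hy]
  rw [pd_eq_evalAt hΩ hD hDr ht hy k (b i j) fun z hz => hS z hz i j]

end Compare

end SpaceTime

/-! ### Algebra at a boundary point -/

section Boundary

variable {m : ℕ} {G : Field2 m} {y : EuclideanSpace ℝ (Fin (m + 1))}

theorem normal_mul_normal (hG : (G y).PosDef) (i j : Fin (m + 1)) :
    normal G y i * normal G y j = (G y)⁻¹ i 0 * (G y)⁻¹ 0 j / (G y)⁻¹ 0 0 := by
  have hs : (G y)⁻¹ 0 j = (G y)⁻¹ j 0 := by simpa using hG.inv.isHermitian.apply j 0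
  rw [normal, normal, neg_mul_neg, div_mul_div_comm, Real.mul_self_sqrt hG.inv.diag_pos.le, hs]

/-- The inverse of the induced metric is the tangential block of `g^{ij} - ν^i ν^j`. -/
theorem tangential_inv (hG : (G y).PosDef) :
    (tangential G y)⁻¹ = Matrix.of fun α β : Fin m =>
      (G y)⁻¹ α.succ β.succ - normal G y α.succ * normal G y β.succ := by
  have hQ : (G y)⁻¹ 0 0 ≠ 0 := hG.inv.diag_pos.ne'
  have hmul : ∀ i j, ∑ k, G y i k * (G y)⁻¹ k j = (1 : Matrix _ _ ℝ) i j := fun i j => by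
    rw [← Matrix.mul_apply, Matrix.mul_nonsing_inv _ hG.det_pos.ne'.isUnit]
  refine Matrix.inv_eq_right_inv ?_
  ext α β
  have h1 := hmul α.succ β.succ
  have h2 := hmul α.succ 0
  rw [Fin.sum_univ_succ] at h1 h2
  rw [Matrix.one_apply_ne (Fin.succ_ne_zero α)] at h2
  simp only [tangential, Matrix.mul_apply, Matrix.of_apply, normal_mul_normal hG, mul_sub,
    Finset.sum_sub_distrib]
  have h3 : ∑ x : Fin m, G y α.succ x.succ *
      ((G y)⁻¹ x.succ 0 * (G y)⁻¹ 0 β.succ / (G y)⁻¹ 0 0)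
      = (∑ x : Fin m, G y α.succ x.succ * (G y)⁻¹ x.succ 0) * ((G y)⁻¹ 0 β.succ / (G y)⁻¹ 0 0) := by
    rw [Finset.sum_mul]
    exact Finset.sum_congr rfl fun x _ => by ring
  rw [h3, eq_neg_of_add_eq_zero_right h2, eq_sub_of_add_eq' h1]
  have h4 : (1 : Matrix (Fin (m + 1)) (Fin (m + 1)) ℝ) α.succ β.succ
      = (1 : Matrix (Fin m) (Fin m) ℝ) α β := by
    simp [Matrix.one_apply]
  rw [h4]
  field_simp
  ring

/-- The boundary trace of the tangential block of `X` is `(g^{ij} - ν^i ν^j) X_{ij}`. -/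
theorem boundaryTrace_of_succ (hG : (G y).PosDef) (X : Fin (m + 1) → Fin (m + 1) → ℝ) :
    boundaryTrace G y (Matrix.of fun α β : Fin m => X α.succ β.succ)
      = ∑ i, ∑ j, ((G y)⁻¹ i j - normal G y i * normal G y j) * X i j := by
  have hQ : (G y)⁻¹ 0 0 ≠ 0 := hG.inv.diag_pos.ne'
  have h0 : ∀ j, (G y)⁻¹ 0 j - normal G y 0 * normal G y j = 0 := fun j => by
    rw [normal_mul_normal hG]; field_simp; ring
  have h0' : ∀ i, (G y)⁻¹ i 0 - normal G y i * normal G y 0 = 0 := fun i => by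
    rw [normal_mul_normal hG]; field_simp; ring
  simp only [Fin.sum_univ_succ (n := m), h0, h0', boundaryTrace, tangential_inv hG,
    Matrix.of_apply, zero_mul, Finset.sum_const_zero, zero_add]

theorem boundaryTrace_sub (A B : Matrix (Fin m) (Fin m) ℝ) :
    boundaryTrace G y (A - B) = boundaryTrace G y A - boundaryTrace G y B := by
  simp only [boundaryTrace, Matrix.sub_apply, mul_sub, Finset.sum_sub_distrib]

theorem boundaryTrace_smul (c : ℝ) (A : Matrix (Fin m) (Fin m) ℝ) :
    boundaryTrace G y (c • A) = c * boundaryTrace G y A := by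
  simp only [boundaryTrace, Matrix.smul_apply, smul_eq_mul, Finset.mul_sum]
  exact Finset.sum_congr rfl fun α _ => Finset.sum_congr rfl fun β _ => by ring

theorem boundaryTrace_metric (hG : (G y).PosDef) :
    boundaryTrace G y (tangential G y) = m := by
  have hT : (tangential G y).PosDef := hG.submatrix (Fin.succ_injective m)
  have hs : (tangential G y).IsSymm := by simpa using hT.isHermitian
  calc boundaryTrace G y (tangential G y)
      = ((tangential G y)⁻¹ * tangential G y).trace := by
        simp only [boundaryTrace, Matrix.trace, Matrix.diag, Matrix.mul_apply]
        exact Finset.sum_congr rfl fun α _ => Finset.sum_congr rfl fun β _ => by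
          rw [hs.apply α β]
    _ = m := by rw [Matrix.nonsing_inv_mul _ hT.det_pos.ne'.isUnit]; simp

/-- Since `g_{kl} ν^l = -δ_k^0 / √(g^{00})`, the second fundamental form is
`h_{αβ} = Γ^0_{αβ} / √(g^{00})`. -/
theorem secondFF_apply (hG : (G y).PosDef) (α β : Fin m) :
    secondFF G y α β = christoffel G 0 α.succ β.succ y / √((G y)⁻¹ 0 0) := by
  have hmul : ∀ k, ∑ l, G y k l * (G y)⁻¹ l 0 =
      (1 : Matrix (Fin (m + 1)) (Fin (m + 1)) ℝ) k 0 := fun k => by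
    rw [← Matrix.mul_apply, Matrix.mul_nonsing_inv _ hG.det_pos.ne'.isUnit]
  have h : ∀ k, ∑ l, G y k l * christoffel G k α.succ β.succ y * normal G y l
      = -(christoffel G k α.succ β.succ y / √((G y)⁻¹ 0 0))
        * (1 : Matrix (Fin (m + 1)) (Fin (m + 1)) ℝ) k 0 :=
    fun k => by
      rw [← hmul k, Finset.mul_sum]
      exact Finset.sum_congr rfl fun l _ => by rw [normal]; ring
  simp [secondFF, h, Matrix.one_apply]

/-- The trace of the variation of the second fundamental form: the contracted Bianchi identity
cancels the terms contracted with `g^{ij}`, and the remaining ones, contracted with `ν^i ν^j`, are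
all equal up to sign. -/
theorem boundaryTrace_variation (hG : (G y).PosDef)
    (C : Fin (m + 1) → Fin (m + 1) → Fin (m + 1) → ℝ)
    (hC : ∀ j, 2 * ∑ l, ∑ k, (G y)⁻¹ l k * C l j k = ∑ l, ∑ k, (G y)⁻¹ l k * C l k j) :
    boundaryTrace G y (Matrix.of fun α β : Fin m => ∑ l, normal G y l *
        (C β.succ l α.succ + C α.succ l β.succ - C α.succ β.succ l))
      = -∑ i, ∑ j, ∑ k, C i j k * normal G y i * normal G y j * normal G y k := by
  rw [boundaryTrace_of_succ hG fun i j => ∑ l, normal G y l * (C j l i + C i l j - C i j l)]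
  set N := normal G y
  set Q := (G y)⁻¹
  have hs : ∀ i j, Q i j = Q j i := fun i j => by simpa using (hG.inv.isHermitian.apply i j).symm
  have hQ : ∑ i, ∑ j, Q i j * ∑ l, N l * (C j l i + C i l j - C i j l) = 0 := by
    calc ∑ i, ∑ j, Q i j * ∑ l, N l * (C j l i + C i l j - C i j l)
        = ∑ i, ∑ l, ∑ j, N l * (Q i j * (C j l i + C i l j - C i j l)) := by
          refine Finset.sum_congr rfl fun i _ => ?_
          simp only [Finset.mul_sum]
          rw [Finset.sum_comm]
          exact Finset.sum_congr rfl fun l _ => Finset.sum_congr rfl fun j _ => by ring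
      _ = ∑ l, N l * ∑ i, ∑ j, Q i j * (C j l i + C i l j - C i j l) := by
          rw [Finset.sum_comm]
          simp only [Finset.mul_sum]
      _ = 0 := Finset.sum_eq_zero fun l _ => by
          have h1 : ∑ i, ∑ j, Q i j * C j l i = ∑ i, ∑ j, Q i j * C i l j := by
            rw [Finset.sum_comm]
            exact Finset.sum_congr rfl fun i _ => Finset.sum_congr rfl fun j _ => by rw [hs]
          simp only [mul_add, mul_sub, Finset.sum_add_distrib, Finset.sum_sub_distrib]
          rw [h1, ← mul_add, ← mul_sub, ← hC l]
          ring
  have hN : ∑ i, ∑ j, N i * N j * ∑ l, N l * (C j l i + C i l j - C i j l)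
      = ∑ i, ∑ j, ∑ k, C i j k * N i * N j * N k := by
    have e1 : ∑ i, ∑ j, ∑ l, N i * N j * (N l * C j l i)
        = ∑ i, ∑ j, ∑ k, C i j k * N i * N j * N k := by
      rw [Finset.sum_comm]
      refine Finset.sum_congr rfl fun j _ => ?_
      rw [Finset.sum_comm]
      exact Finset.sum_congr rfl fun l _ => Finset.sum_congr rfl fun j _ => by ring
    have e2 : ∑ i, ∑ j, ∑ l, N i * N j * (N l * C i l j)
        = ∑ i, ∑ j, ∑ k, C i j k * N i * N j * N k := by
      refine Finset.sum_congr rfl fun j _ => ?_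
      rw [Finset.sum_comm]
      exact Finset.sum_congr rfl fun l _ => Finset.sum_congr rfl fun j _ => by ring
    have e3 : ∑ i, ∑ j, ∑ l, N i * N j * (N l * C i j l)
        = ∑ i, ∑ j, ∑ k, C i j k * N i * N j * N k :=
      Finset.sum_congr rfl fun j _ => Finset.sum_congr rfl fun l _ =>
        Finset.sum_congr rfl fun j _ => by ring
    simp only [mul_add, mul_sub, Finset.sum_add_distrib, Finset.sum_sub_distrib, Finset.mul_sum]
    rw [e1, e2, e3]
    ring
  simp only [sub_mul, Finset.sum_sub_distrib, hQ, hN, zero_sub]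

end Boundary

/-! ### Ricci flow in a domain of the half space -/

section Flow

open smoothOn Formal

variable {m : ℕ} {T : ℝ} {D : Set (EuclideanSpace ℝ (Fin (m + 1)))}
  {γ : ℝ → Field2 m}

/-- The components of a smooth family of metrics, as elements of the algebra of smooth functions on
space-time. -/
noncomputable def metricOn
    (hγ : ∀ i j, ContDiffOn ℝ ∞ (fun q : ℝ × EuclideanSpace ℝ (Fin (m + 1)) =>
      γ q.1 q.2 i j) (Set.Ioo 0 T ×ˢ D)) :
    Matrix (Fin (m + 1)) (Fin (m + 1)) (smoothOn (Set.Ioo 0 T ×ˢ D)) :=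
  Matrix.of fun i j => mk _ (hγ i j)

variable (hγ : ∀ i j, ContDiffOn ℝ ∞ (fun q : ℝ × EuclideanSpace ℝ (Fin (m + 1)) =>
      γ q.1 q.2 i j) (Set.Ioo 0 T ×ˢ D))
  (hpos : ∀ t ∈ Set.Ioo 0 T, ∀ y ∈ D, (γ t y).PosDef)

include hpos

theorem metricOn_isSymm : (metricOn hγ).IsSymm := by
  ext i j : 1
  refine ext_evalAt fun x hx => ?_
  simpa [metricOn, evalAt_mk] using (hpos x.1 hx.1 x.2 hx.2).isHermitian.apply i j

/-- The inverse matrix has smooth entries, since the determinant vanishes nowhere. -/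
theorem metricOn_mul_inv : metricOn hγ * (metricOn hγ)⁻¹ = 1 := by
  refine Matrix.mul_nonsing_inv _ (isUnit_of_evalAt_ne_zero _ fun x hx => ?_)
  rw [AlgHom.map_det]
  exact (hpos x.1 hx.1 x.2 hx.2).det_pos.ne'

variable (hΩ : UniqueDiffOn ℝ (Set.Ioo 0 T ×ˢ D))
  (hΩ' : Set.Ioo 0 T ×ˢ D ⊆ closure (interior (Set.Ioo 0 T ×ˢ D)))
  (hD : ∀ y ∈ D, D ∈ nhdsWithin y (Set.range (𝓡∂ (m + 1))))
  (hDr : D ⊆ Set.range (𝓡∂ (m + 1)))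
  {t : ℝ} (ht : t ∈ Set.Ioo 0 T) {y : EuclideanSpace ℝ (Fin (m + 1))} (hy : y ∈ D)

include hγ hΩ hΩ' hD hDr ht hy

omit hΩ' in
theorem covDeriv_ricci_eq_evalAt (i j k : Fin (m + 1)) :
    covDeriv (γ t) (ricci (γ t)) i j k y = evalAt (t, y) (Set.mk_mem_prod ht hy)
      (cov (spaceDeriv hΩ) (metricOn hγ) (metricOn hγ)⁻¹
        (ric (spaceDeriv hΩ) (metricOn hγ) (metricOn hγ)⁻¹) i j k) :=
  covDeriv_eq_evalAt hΩ hD hDr (metricOn_mul_inv hγ hpos) ht (fun _ _ _ _ => rfl) hy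
    (fun _ hz => ricci_eq_evalAt hΩ hD hDr (metricOn_mul_inv hγ hpos) ht (fun _ _ _ _ => rfl)
      (metricOn_isSymm hγ hpos) hz) i j k

/-- The contracted Bianchi identity for `γ t`. -/
theorem contracted_bianchi_ricci (j : Fin (m + 1)) :
    2 * ∑ l, ∑ k, (γ t y)⁻¹ l k * covDeriv (γ t) (ricci (γ t)) l j k y
      = ∑ l, ∑ k, (γ t y)⁻¹ l k * covDeriv (γ t) (ricci (γ t)) l k j y := by
  have h := congrArg (evalAt (t, y) (Set.mk_mem_prod ht hy))
    (contracted_bianchi (d := spaceDeriv hΩ) (fun _ _ => dirDeriv_comm hΩ hΩ' _ _)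
      (metricOn_isSymm hγ hpos) (metricOn_mul_inv hγ hpos) j)
  simpa only [map_mul, map_ofNat, map_sum,
    ← covDeriv_ricci_eq_evalAt hγ hpos hΩ hD hDr ht hy,
    ← inv_eq_evalAt (metricOn_mul_inv hγ hpos) ht (G := γ t) (fun _ _ _ _ => rfl) hy] using h

variable (hflow : ∀ t ∈ Set.Ioo 0 T, ∀ y ∈ D, ∀ i j,
  HasDerivAt (fun s => γ s y i j) (-2 * ricci (γ t) y i j) t)

include hflow

omit hΩ' ht hy in
/-- The Ricci flow equation `∂_t g = -2 Ric`, in the algebra of smooth functions. -/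
theorem entrywise_metricOn :
    entrywise (dirDeriv hΩ (1, 0)) (metricOn hγ)
      = (-2 : ℝ) • ric (spaceDeriv hΩ) (metricOn hγ) (metricOn hγ)⁻¹ := by
  ext i j : 1
  ext ⟨⟨t, y⟩, ht, hy⟩
  have h1 := hasDerivAt_evalAt hΩ ht hy (metricOn hγ i j) (f := fun s => γ s y i j)
    fun _ _ => rfl
  have h2 := h1.unique (hflow t ht y hy i j)
  rw [ricci_eq_evalAt hΩ hD hDr (metricOn_mul_inv hγ hpos) ht (fun _ _ _ _ => rfl)
      (metricOn_isSymm hγ hpos) hy] at h2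
  exact h2

/-- The variation of the Christoffel symbols under Ricci flow. -/
theorem hasDerivAt_christoffel (k i j : Fin (m + 1)) :
    HasDerivAt (fun s => christoffel (γ s) k i j y)
      (-∑ l, (γ t y)⁻¹ k l * (covDeriv (γ t) (ricci (γ t)) j l i y
        + covDeriv (γ t) (ricci (γ t)) i l j y - covDeriv (γ t) (ricci (γ t)) i j l y)) t := by
  have hQ := metricOn_mul_inv hγ hpos
  convert! hasDerivAt_evalAt hΩ ht hy
    (chr (spaceDeriv hΩ) (metricOn hγ) (metricOn hγ)⁻¹ k i j)
    (f := fun s => christoffel (γ s) k i j y)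
    fun s hs => christoffel_eq_evalAt hΩ hD hDr hQ hs (fun _ _ _ _ => rfl) hy k i j using 1
  rw [derivation_chr _ (fun _ => dirDeriv_comm hΩ hΩ' _ _) (metricOn_isSymm hγ hpos) hQ,
    entrywise_metricOn hγ hpos hΩ hD hDr hflow]
  simp only [cov_smul, map_smul, map_sum, map_mul, map_sub, map_add, smul_eq_mul,
    ← covDeriv_ricci_eq_evalAt hγ hpos hΩ hD hDr ht hy,
    ← inv_eq_evalAt hQ ht (G := γ t) (fun _ _ _ _ => rfl) hy]
  rw [Finset.mul_sum, ← Finset.sum_neg_distrib]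
  exact Finset.sum_congr rfl fun l _ => by ring

omit hΩ' in
/-- The variation `∂_t g^{00} = 2 g^{00} R_{νν}`. -/
theorem hasDerivAt_inv_zero_zero :
    HasDerivAt (fun s => (γ s y)⁻¹ 0 0) (2 * (γ t y)⁻¹ 0 0 * ricciNormal (γ t) y) t := by
  have hQ := metricOn_mul_inv hγ hpos
  have hs : ∀ i j, (γ t y)⁻¹ i j = (γ t y)⁻¹ j i := fun i j => by
    simpa using ((hpos t ht y hy).inv.isHermitian.apply i j).symm
  have hQ0 : (γ t y)⁻¹ 0 0 ≠ 0 := (hpos t ht y hy).inv.diag_pos.ne'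
  have h := hasDerivAt_evalAt hΩ ht hy ((metricOn hγ)⁻¹ 0 0) (f := fun s => (γ s y)⁻¹ 0 0)
    fun s hs => inv_eq_evalAt hQ hs (G := γ s) (fun _ _ _ _ => rfl) hy 0 0
  convert! h using 1
  rw [← entrywise_apply, entrywise_inv _ hQ, entrywise_metricOn hγ hpos hΩ hD hDr hflow]
  simp only [Matrix.neg_apply, Matrix.mul_apply, Matrix.smul_apply, map_neg, map_sum, map_mul,
    map_smul, smul_eq_mul, ← inv_eq_evalAt hQ ht (G := γ t) (fun _ _ _ _ => rfl) hy,
    ← ricci_eq_evalAt hΩ hD hDr hQ ht (G := γ t) (fun _ _ _ _ => rfl)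
      (metricOn_isSymm hγ hpos) hy]
  simp only [ricciNormal, mul_assoc, normal_mul_normal (hpos t ht y hy), Finset.mul_sum,
    Finset.sum_mul, ← Finset.sum_neg_distrib]
  rw [Finset.sum_comm]
  refine Finset.sum_congr rfl fun i _ => Finset.sum_congr rfl fun j _ => ?_
  rw [hs j 0, hs 0 i]
  field_simp

/-- Under Ricci flow, `∂_t h_{αβ} = R_{βν|α} + R_{αν|β} - R_{αβ|ν} - R_{νν} h_{αβ}`. -/
theorem hasDerivAt_secondFF (α β : Fin m) :
    HasDerivAt (fun s => secondFF (γ s) y α β)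
      (∑ l, normal (γ t) y l * (covDeriv (γ t) (ricci (γ t)) β.succ l α.succ y
          + covDeriv (γ t) (ricci (γ t)) α.succ l β.succ y
          - covDeriv (γ t) (ricci (γ t)) α.succ β.succ l y)
        - ricciNormal (γ t) y * secondFF (γ t) y α β) t := by
  have hp := hpos t ht y hy
  have hQ0 : 0 < (γ t y)⁻¹ 0 0 := hp.inv.diag_pos
  have hd := (hasDerivAt_christoffel hγ hpos hΩ hΩ' hD hDr ht hy hflow 0 α.succ β.succ).div
    ((hasDerivAt_inv_zero_zero hγ hpos hΩ hD hDr ht hy hflow).sqrt hQ0.ne')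
    (Real.sqrt_ne_zero'.mpr hQ0)
  have he : (fun s => secondFF (γ s) y α β) =ᶠ[nhds t]
      fun s => christoffel (γ s) 0 α.succ β.succ y / √((γ s y)⁻¹ 0 0) := by
    filter_upwards [isOpen_Ioo.mem_nhds ht] with s hs
    exact secondFF_apply (hpos s hs y hy) α β
  refine (hd.congr_of_eventuallyEq he).congr_deriv ?_
  rw [secondFF_apply hp]
  have hN : ∀ v : Fin (m + 1) → ℝ, ∑ l, normal (γ t) y l * v l
      = -(∑ l, (γ t y)⁻¹ 0 l * v l) / √((γ t y)⁻¹ 0 0) := fun v => by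
    rw [← Finset.sum_neg_distrib, Finset.sum_div]
    refine Finset.sum_congr rfl fun l _ => ?_
    have hs : (γ t y)⁻¹ 0 l = (γ t y)⁻¹ l 0 := by simpa using hp.inv.isHermitian.apply l 0
    rw [normal, hs]
    ring
  rw [hN]
  have hr := Real.sqrt_ne_zero'.mpr hQ0
  have hr2 := Real.sq_sqrt hQ0.le
  set r := √((γ t y)⁻¹ 0 0)
  rw [← hr2]
  field_simp

/-- The normal derivative of the normal Ricci curvature under Ricci flow, in terms of the variation
of the second fundamental form. No boundary condition is needed. -/
theorem ricciNormalDeriv_eq :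
    ∃ h' : Matrix (Fin m) (Fin m) ℝ,
      (∀ α β, HasDerivAt (fun s => secondFF (γ s) y α β) (h' α β) t) ∧
      ricciNormalDeriv (γ t) y
        = -boundaryTrace (γ t) y h' - meanCurvature (γ t) y * ricciNormal (γ t) y := by
  refine ⟨(Matrix.of fun α β : Fin m => ∑ l, normal (γ t) y l *
      (covDeriv (γ t) (ricci (γ t)) β.succ l α.succ y
        + covDeriv (γ t) (ricci (γ t)) α.succ l β.succ y
        - covDeriv (γ t) (ricci (γ t)) α.succ β.succ l y))
      - ricciNormal (γ t) y • secondFF (γ t) y,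
    hasDerivAt_secondFF hγ hpos hΩ hΩ' hD hDr ht hy hflow, ?_⟩
  rw [boundaryTrace_sub, boundaryTrace_smul,
    boundaryTrace_variation (hpos t ht y hy) (fun i j k => covDeriv (γ t) (ricci (γ t)) i j k y)
      (contracted_bianchi_ricci hγ hpos hΩ hΩ' hD hDr ht hy), meanCurvature, ricciNormalDeriv]
  ring

end Flow

/-! ### Charts of the manifold -/

section Charts

variable {m : ℕ} {M : Type*} [TopologicalSpace M]
    {e : OpenPartialHomeomorph M (EuclideanHalfSpace (m + 1))}

theorem extend_target_mem_nhdsWithin_range {y : EuclideanSpace ℝ (Fin (m + 1))}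
    (hy : y ∈ (e.extend (𝓡∂ (m + 1))).target) :
    (e.extend (𝓡∂ (m + 1))).target ∈ nhdsWithin y (Set.range (𝓡∂ (m + 1))) := by
  have h := e.extend_target_mem_nhdsWithin (I := 𝓡∂ (m + 1))
    (e.extend_source (I := 𝓡∂ (m + 1)) ▸ (e.extend (𝓡∂ (m + 1))).map_target hy)
  rwa [(e.extend (𝓡∂ (m + 1))).right_inv hy] at h

theorem uniqueDiffOn_extend_target :
    UniqueDiffOn ℝ (e.extend (𝓡∂ (m + 1))).target := by
  rw [e.extend_target, Set.inter_comm]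
  exact (𝓡∂ (m + 1)).uniqueDiffOn.inter (e.open_target.preimage (𝓡∂ (m + 1)).continuous_symm)

theorem extend_target_subset_closure_interior :
    (e.extend (𝓡∂ (m + 1))).target ⊆ closure (interior (e.extend (𝓡∂ (m + 1))).target) := by
  have hU := e.open_target.preimage (𝓡∂ (m + 1)).continuous_symm
  rw [e.extend_target, interior_inter, hU.interior_eq]
  exact (Set.inter_subset_inter_right _ (𝓡∂ (m + 1)).range_subset_closure_interior).trans
    hU.inter_closure

variable [ChartedSpace (EuclideanHalfSpace (m + 1)) M] [IsManifold (𝓡∂ (m + 1)) ∞ M]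

/-- The coordinate vectors of a chart are linearly independent: the derivative of the inverse of the
chart has the derivative of the chart as a left inverse. -/
theorem mfderivWithin_extend_symm_injective (he : e ∈ atlas (EuclideanHalfSpace (m + 1)) M)
    {y : EuclideanSpace ℝ (Fin (m + 1))} (hy : y ∈ (e.extend (𝓡∂ (m + 1))).target) :
    Function.Injective (mfderivWithin 𝓘(ℝ, EuclideanSpace ℝ (Fin (m + 1))) (𝓡∂ (m + 1))
      (e.extend (𝓡∂ (m + 1))).symm (Set.range (𝓡∂ (m + 1))) y) := by
  have he' : e ∈ IsManifold.maximalAtlas (𝓡∂ (m + 1)) ∞ M := IsManifold.subset_maximalAtlas he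
  have hr : y ∈ Set.range (𝓡∂ (m + 1)) := e.extend_target_subset_range hy
  have U := (𝓡∂ (m + 1)).uniqueMDiffOn y hr
  have hx : (e.extend (𝓡∂ (m + 1))).symm y ∈ e.source :=
    e.extend_source (I := 𝓡∂ (m + 1)) ▸ (e.extend (𝓡∂ (m + 1))).map_target hy
  have h1 : MDifferentiableAt (𝓡∂ (m + 1)) 𝓘(ℝ, EuclideanSpace ℝ (Fin (m + 1)))
      (e.extend (𝓡∂ (m + 1))) ((e.extend (𝓡∂ (m + 1))).symm y) :=
    (e.contMDiffAt_extend he' hx).mdifferentiableAt (by simp)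
  have h2 : MDifferentiableWithinAt 𝓘(ℝ, EuclideanSpace ℝ (Fin (m + 1))) (𝓡∂ (m + 1))
      (e.extend (𝓡∂ (m + 1))).symm (Set.range (𝓡∂ (m + 1))) y := by
    have h := contMDiffOn_extend_symm he'
    rw [← e.extend_target'] at h
    exact ((h y hy).mdifferentiableWithinAt (by simp)).mono_of_mem_nhdsWithin
      (extend_target_mem_nhdsWithin_range hy)
  have hcomp := mfderiv_comp_mfderivWithin y h1 h2 U
  have hid : mfderivWithin 𝓘(ℝ, EuclideanSpace ℝ (Fin (m + 1)))
      𝓘(ℝ, EuclideanSpace ℝ (Fin (m + 1)))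
      (e.extend (𝓡∂ (m + 1)) ∘ (e.extend (𝓡∂ (m + 1))).symm) (Set.range (𝓡∂ (m + 1))) y
      = ContinuousLinearMap.id ℝ _ := by
    rw [← mfderivWithin_id U]
    apply Filter.EventuallyEq.mfderivWithin_eq
    · filter_upwards [extend_target_mem_nhdsWithin_range hy] with z hz
      simp only [Function.comp_def, (e.extend (𝓡∂ (m + 1))).right_inv hz, id_eq]
    · simp only [Function.comp_def, (e.extend (𝓡∂ (m + 1))).right_inv hy, id_eq]
  rw [hid] at hcomp
  intro v w hvw
  have h3 := DFunLike.congr_fun hcomp v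
  have h4 := DFunLike.congr_fun hcomp w
  simp only [ContinuousLinearMap.comp_apply] at h3 h4
  rw [hvw] at h3
  exact h3.trans h4.symm

theorem components_posDef (g : Metric m M) (he : e ∈ atlas (EuclideanHalfSpace (m + 1)) M)
    {y : EuclideanSpace ℝ (Fin (m + 1))} (hy : y ∈ (e.extend (𝓡∂ (m + 1))).target) :
    (components g e y).PosDef := by
  refine Matrix.PosDef.of_dotProduct_mulVec_pos ?_ fun v hv => ?_
  · ext i j
    exact g.symm _ _ _
  · have hinj := mfderivWithin_extend_symm_injective he hy
    set L := mfderivWithin 𝓘(ℝ, EuclideanSpace ℝ (Fin (m + 1))) (𝓡∂ (m + 1))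
      (e.extend (𝓡∂ (m + 1))).symm (Set.range (𝓡∂ (m + 1))) y with hL
    have hw : L (WithLp.toLp 2 v) ≠ 0 := fun h0 => hv <| by
      have := hinj (h0.trans (map_zero L).symm)
      exact (WithLp.toLp_eq_zero 2).mp this
    have hpos := g.pos _ _ hw
    have hsum : L (WithLp.toLp 2 v) = ∑ i, v i • L (EuclideanSpace.single i 1) := by
      have hv' : WithLp.toLp 2 v = ∑ i, v i • EuclideanSpace.single i (1 : ℝ) := by
        ext j
        simp [Pi.single_apply]
      rw [hv']
      exact (map_sum L _ _).trans (Finset.sum_congr rfl fun i _ => map_smul L _ _)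
    rw [hsum] at hpos
    simp only [map_sum, map_smul, sum_apply, smul_apply, smul_eq_mul] at hpos
    simp only [dotProduct, Matrix.mulVec, components, Matrix.of_apply, star_trivial]
    convert! hpos using 1
    exact Finset.sum_congr rfl fun i _ => congrArg _ (Finset.sum_congr rfl fun j _ =>
      (mul_comm _ _).trans (congrArg _ (g.symm _ _ _)))

end Charts

end RicciBoundary

open RicciBoundary in
theorem mainTheorem6 (m : ℕ) (M : Type*) [TopologicalSpace M]
    [ChartedSpace (EuclideanHalfSpace (m + 1)) M] [IsManifold (𝓡∂ (m + 1)) ∞ M]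
    (g : ℝ → RicciBoundary.Metric m M) (κ T : ℝ)
    (hg : RicciBoundary.IsUmbilicRicciFlow g κ T)
    (t : ℝ) (ht : t ∈ Set.Ioo 0 T)
    (p : M) (hp : p ∈ (𝓡∂ (m + 1)).boundary M)
    (e : OpenPartialHomeomorph M (EuclideanHalfSpace (m + 1)))
    (he : e ∈ atlas (EuclideanHalfSpace (m + 1)) M) (hpe : p ∈ e.source)
    (y : EuclideanSpace ℝ (Fin (m + 1))) (hy : y = e.extend (𝓡∂ (m + 1)) p)
    (G : RicciBoundary.Field2 m) (hG : G = RicciBoundary.components (g t) e) :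
    (∃ h' : Matrix (Fin m) (Fin m) ℝ,
      (∀ α β, HasDerivAt
        (fun s => RicciBoundary.secondFF (RicciBoundary.components (g s) e) y α β) (h' α β) t) ∧
      RicciBoundary.ricciNormalDeriv G y
        = -RicciBoundary.boundaryTrace G y h'
          - RicciBoundary.meanCurvature G y * RicciBoundary.ricciNormal G y) ∧
    RicciBoundary.ricciNormalDeriv G y
      = 2 * κ * RicciBoundary.boundaryTrace G y
            (RicciBoundary.tangential (RicciBoundary.ricci G) y)
        - m * κ * RicciBoundary.ricciNormal G y ∧
    (m + 1 = 3 → RicciBoundary.ricciNormalDeriv G y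
      = 2 * κ * (RicciBoundary.boundaryTrace G y
            (RicciBoundary.tangential (RicciBoundary.ricci G) y)
        - RicciBoundary.ricciNormal G y)) := by
  subst hG hy
  set y := e.extend (𝓡∂ (m + 1)) p with hy
  have hyD : y ∈ (e.extend (𝓡∂ (m + 1))).target :=
    (e.extend (𝓡∂ (m + 1))).map_source (e.extend_source (I := 𝓡∂ (m + 1)) ▸ hpe)
  have hpos : ∀ t ∈ Set.Ioo 0 T, ∀ z ∈ (e.extend (𝓡∂ (m + 1))).target,
      (components (g t) e z).PosDef := fun t _ z hz => components_posDef (g t) he hz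
  have hflow : ∀ t ∈ Set.Ioo 0 T, ∀ z ∈ (e.extend (𝓡∂ (m + 1))).target, ∀ i j,
      HasDerivAt (fun s => components (g s) e z i j)
        (-2 * ricci (components (g t) e) z i j) t := fun t ht z hz i j => by
    have h := hg.flow e he t ht ((e.extend (𝓡∂ (m + 1))).symm z)
      (e.extend_source (I := 𝓡∂ (m + 1)) ▸ (e.extend (𝓡∂ (m + 1))).map_target hz) i j
    rwa [(e.extend (𝓡∂ (m + 1))).right_inv hz] at h
  obtain ⟨h', hh', hR⟩ := ricciNormalDeriv_eq (γ := fun s => components (g s) e)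
    (hg.smooth e he) hpos (isOpen_Ioo.uniqueDiffOn.prod uniqueDiffOn_extend_target)
    (by
      rw [interior_prod_eq, closure_prod_eq, isOpen_Ioo.interior_eq]
      exact Set.prod_mono subset_closure extend_target_subset_closure_interior)
    (fun _ => extend_target_mem_nhdsWithin_range) e.extend_target_subset_range ht hyD hflow
  -- The boundary condition holds at all times, so it can be differentiated in time.
  have hvar : h' = (-2 * κ) • tangential (ricci (components (g t) e)) y := by
    ext α β
    have hu : (fun s => secondFF (components (g s) e) y α β) =ᶠ[nhds t]
        fun s => κ * components (g s) e y α.succ β.succ := by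
      filter_upwards [isOpen_Ioo.mem_nhds ht] with s hs
      rw [hy, hg.umbilic e he s hs p hpe hp]
      rfl
    rw [(hh' α β).unique (((hflow t ht y hyD α.succ β.succ).const_mul κ).congr_of_eventuallyEq hu)]
    simp only [tangential, Matrix.smul_apply, Matrix.of_apply, smul_eq_mul]
    ring
  have hH : meanCurvature (components (g t) e) y = m * κ := by
    rw [meanCurvature, hy, hg.umbilic e he t ht p hpe hp, boundaryTrace_smul,
      boundaryTrace_metric (hpos t ht y hyD), mul_comm]
  have hmain : ricciNormalDeriv (components (g t) e) y
      = 2 * κ * boundaryTrace (components (g t) e) y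
            (tangential (ricci (components (g t) e)) y)
        - m * κ * ricciNormal (components (g t) e) y := by
    rw [hR, hH, hvar, boundaryTrace_smul]
    ring
  refine ⟨⟨h', hh', hR⟩, hmain, fun hm => ?_⟩
  obtain rfl : m = 2 := by omega
  rw [hmain]
  push_cast
  ring
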